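/- A coloring of a finite simple graph $G=(V,E)$ is a map $c\colon V\to\{0,1,2,\dots\}$ with $c(u)\ne c(v)$ for adjacent $u,v$. A set $D\subseteq V$ is an up-color dominating $c$-set of $(G,c)$ if (1) every vertex $v\notin D$ has a neighbor $d\in D$ with $c(v)<c(d)$, and (2) $D$ contains no vertex of color $0$. The smallest cardinality of an up-color dominating $c$-set is denoted by $\gamma_{uc}(G,c)$, and an up-color dominating $c$-set of this cardinality is called a $\gamma_{uc}$-dominating $c$-set. Theorem. There are an algorithm and a constant $C$ such that for every tree $T$ with $n$ vertices and every coloring $c$ of $T$ — except for the one-vertex tree with color $0$, which has no up-color dominating $c$-set — the algorithm finds a $\gamma_{uc}$-dominating $c$-set of $(T,c)$ in at most $Cn$ steps. Here the vertices of $T$ are numbered $0,\dots,n-1$, and $T$ is given by adjacency lists (in any order) together with the list of the colors of its vertices. Steps are counted on a unit-cost random access machine with finitely many registers and arrays, each cell of which holds a natural number, whose elementary steps are: setting a register to a constant, copying, adding or subtracting $1$, reading or writing an array cell whose index is in a register, and comparing two registers. -/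

import Mathlib

/-! ### Up-color domination -/

/-- `D` is an up-color dominating `c`-set of `(G, c)`: every vertex outside `D` has a neighbor in
`D` of strictly larger color, and `D` contains no vertex of color `0`. -/
def IsUpColorDominating {V : Type*} (G : SimpleGraph V) (c : G.Coloring ℕ) (D : Finset V) : Prop :=
  (∀ v, v ∉ D → ∃ d ∈ D, G.Adj v d ∧ c v < c d) ∧ ∀ d ∈ D, c d ≠ 0

/-- The up-color domination `c`-number of `(G, c)`: the smallest cardinality of an up-color
dominating `c`-set. -/
noncomputable def upColorDominationNumber {V : Type*} (G : SimpleGraph V) (c : G.Coloring ℕ) : ℕ :=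
  sInf {k : ℕ | ∃ D : Finset V, IsUpColorDominating G c D ∧ D.card = k}

/-- `D` is an up-color dominating `c`-set of the smallest possible cardinality. -/
def IsMinUpColorDominating {V : Type*} (G : SimpleGraph V) (c : G.Coloring ℕ) (D : Finset V) :
    Prop :=
  IsUpColorDominating G c D ∧ D.card = upColorDominationNumber G c

/-! ### Unit-cost random access machine

A program is a finite term, so it mentions only a fixed finite number of registers, arrays and
constants. The only arithmetic operations are successor and predecessor, so after `t` steps no cell
exceeds the maximum of the input and of the constants of the program by more than `t`: unit cost
is not exploited by computing with very long numbers. -/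

/-- Machine state: registers `reg x` and arrays `mem a i` (cell `i` of array `a`), each holding
a natural number. -/
@[ext]
structure RamState where
  reg : ℕ → ℕ
  mem : ℕ → ℕ → ℕ

/-- Set register `x` to `k`. -/
def RamState.setReg (s : RamState) (x k : ℕ) : RamState :=
  { s with reg := Function.update s.reg x k }

/-- Set cell `i` of array `a` to `k`. -/
def RamState.setMem (s : RamState) (a i k : ℕ) : RamState :=
  { s with mem := Function.update s.mem a (Function.update (s.mem a) i k) }

/-- Comparisons of two registers. -/
inductive RamTest where
  | lt (x y : ℕ)
  | eq (x y : ℕ)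

/-- Truth of a comparison in a state. -/
def RamTest.Holds : RamTest → RamState → Prop
  | .lt x y, s => s.reg x < s.reg y
  | .eq x y, s => s.reg x = s.reg y

/-- Elementary instructions. -/
inductive RamInstr where
  /-- `x := k` -/
  | const (x k : ℕ)
  /-- `x := y` -/
  | copy (x y : ℕ)
  /-- `x := x + 1` -/
  | succ (x : ℕ)
  /-- `x := x - 1` (and `0` stays `0`) -/
  | pred (x : ℕ)
  /-- `x := a[i]`, where the index is the content of register `i` -/
  | load (x a i : ℕ)
  /-- `a[i] := x`, where the index is the content of register `i` -/
  | store (a i x : ℕ)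

/-- Effect of an elementary instruction. -/
def RamInstr.apply : RamInstr → RamState → RamState
  | .const x k, s => s.setReg x k
  | .copy x y, s => s.setReg x (s.reg y)
  | .succ x, s => s.setReg x (s.reg x + 1)
  | .pred x, s => s.setReg x (s.reg x - 1)
  | .load x a i, s => s.setReg x (s.mem a (s.reg i))
  | .store a i x, s => s.setMem a (s.reg i) (s.reg x)

/-- Programs. -/
inductive RamProg where
  | skip
  | instr (o : RamInstr)
  | seq (p q : RamProg)
  | cond (b : RamTest) (p q : RamProg)
  | loop (b : RamTest) (p : RamProg)

/-- `RamExec p s t s'`: program `p`, started in state `s`, halts in state `s'` after exactly `t`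
steps. Each elementary instruction and each evaluation of a comparison is one step. -/
inductive RamExec : RamProg → RamState → ℕ → RamState → Prop where
  | skip (s : RamState) : RamExec .skip s 1 s
  | instr (o : RamInstr) (s : RamState) : RamExec (.instr o) s 1 (o.apply s)
  | seq {p q : RamProg} {s s' s'' : RamState} {t t' : ℕ} :
      RamExec p s t s' → RamExec q s' t' s'' → RamExec (.seq p q) s (t + t') s''
  | cond_true {b : RamTest} {p q : RamProg} {s s' : RamState} {t : ℕ} :
      b.Holds s → RamExec p s t s' → RamExec (.cond b p q) s (1 + t) s'
  | cond_false {b : RamTest} {p q : RamProg} {s s' : RamState} {t : ℕ} :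
      ¬ b.Holds s → RamExec q s t s' → RamExec (.cond b p q) s (1 + t) s'
  | loop_done {b : RamTest} {p : RamProg} {s : RamState} :
      ¬ b.Holds s → RamExec (.loop b p) s 1 s
  | loop_step {b : RamTest} {p : RamProg} {s s' s'' : RamState} {t t' : ℕ} :
      b.Holds s → RamExec p s t s' → RamExec (.loop b p) s' t' s'' →
        RamExec (.loop b p) s (1 + t + t') s''

/-- The machine is deterministic: final state and number of steps are determined by the program
and the initial state. -/
theorem RamExec.deterministic {p : RamProg} {s s₁ : RamState} {t₁ : ℕ} (h₁ : RamExec p s t₁ s₁) :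
    ∀ {s₂ : RamState} {t₂ : ℕ}, RamExec p s t₂ s₂ → t₁ = t₂ ∧ s₁ = s₂ := by
  induction h₁ with
  | skip s => intro s₂ t₂ h; cases h; exact ⟨rfl, rfl⟩
  | instr o s => intro s₂ t₂ h; cases h; exact ⟨rfl, rfl⟩
  | seq _ _ ih₁ ih₂ =>
    intro s₂ t₂ h
    cases h with
    | seq k₁ k₂ =>
      obtain ⟨rfl, rfl⟩ := ih₁ k₁
      obtain ⟨rfl, rfl⟩ := ih₂ k₂
      exact ⟨rfl, rfl⟩
  | cond_true hb _ ih =>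
    intro s₂ t₂ h
    cases h with
    | cond_true _ k => obtain ⟨rfl, rfl⟩ := ih k; exact ⟨rfl, rfl⟩
    | cond_false hb' _ => exact absurd hb hb'
  | cond_false hb _ ih =>
    intro s₂ t₂ h
    cases h with
    | cond_true hb' _ => exact absurd hb' hb
    | cond_false _ k => obtain ⟨rfl, rfl⟩ := ih k; exact ⟨rfl, rfl⟩
  | loop_done hb =>
    intro s₂ t₂ h
    cases h with
    | loop_done _ => exact ⟨rfl, rfl⟩
    | loop_step hb' _ _ => exact absurd hb' hb
  | loop_step hb _ _ ih₁ ih₂ =>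
    intro s₂ t₂ h
    cases h with
    | loop_done hb' => exact absurd hb hb'
    | loop_step _ k₁ k₂ =>
      obtain ⟨rfl, rfl⟩ := ih₁ k₁
      obtain ⟨rfl, rfl⟩ := ih₂ k₂
      exact ⟨rfl, rfl⟩

/-! ### Input and output of graph algorithms -/

/-- `nbrs` is an adjacency-list representation of `G`: `nbrs v` lists the neighbors of `v`,
each once, in an arbitrary order. -/
def IsAdjacencyList {n : ℕ} (G : SimpleGraph (Fin n)) (nbrs : Fin n → List (Fin n)) : Prop :=
  ∀ v, (nbrs v).Nodup ∧ ∀ w, w ∈ nbrs v ↔ G.Adj v w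

/-- Initial state for a colored graph on the vertices `0, …, n - 1`, given by adjacency lists:
* register `0` holds `n`;
* array `0` holds the colors of the vertices;
* array `2` holds the lists `nbrs 0, nbrs 1, …, nbrs (n - 1)` one after the other;
* array `1` holds in cell `i ≤ n` the position in array `2` at which the list of `i` starts
  (the total length if `i = n`).

Everything else is `0`. -/
def graphInput {n : ℕ} (c : Fin n → ℕ) (nbrs : Fin n → List (Fin n)) : RamState where
  reg x := if x = 0 then n else 0
  mem a i :=
    if a = 0 then (if h : i < n then c ⟨i, h⟩ else 0)
    else if a = 1 then
      (if i ≤ n then (((List.finRange n).take i).flatMap nbrs).length else 0)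
    else if a = 2 then (((List.finRange n).flatMap nbrs).map Fin.val).getD i 0
    else 0

/-- The set `D` of vertices is written in array `3` of `s` as a `0`-`1` vector. -/
def RamState.Outputs {n : ℕ} (s : RamState) (D : Finset (Fin n)) : Prop :=
  ∀ v : Fin n, s.mem 3 v = if v ∈ D then 1 else 0

/-! Root the tree at a vertex of nonzero color and treat the vertices from the leaves upwards. If
the current vertex is neither chosen nor dominated by a child, choose its parent when the parent has
larger color, and otherwise the vertex itself. A chosen parent has larger color than its child. A
non-root vertex chosen for itself has, by properness, larger color than its parent. The root is
nonzero by choice, so color 0 never occurs.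

For optimality, let the up-neighborhood of `w` consist of `w` and its neighbors of larger color. An
up-color dominating set meets every up-neighborhood. Greedy always chooses the vertex nearest the
root in the up-neighborhood of the vertex that forces the choice. Hence these forcing vertices, the
set `W` in `GreedyInv.packing`, have pairwise disjoint up-neighborhoods, and no admissible set is
smaller than `W`, nor than the greedy set (`GreedyInv.step`, `GreedyInv.isMin`).

Breadth-first search supplies the rooting, and its queue read backwards supplies the order
(`IsSearch.isParentMap`). The running time is linear because the degrees of a tree sum to `2 * n -
2`. Program proofs bound time by potentials: `wp_loop` yields termination and the step count
together. -/

/-! ### Reasoning about programs -/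

/-- Program `p`, started in `s`, halts after some number `t` of steps in a state `s'` such that
`Q t s'`. -/
def RamProg.wp (p : RamProg) (s : RamState) (Q : ℕ → RamState → Prop) : Prop :=
  ∃ t s', RamExec p s t s' ∧ Q t s'

namespace RamProg

theorem wp_mono {p : RamProg} {s : RamState} {Q Q' : ℕ → RamState → Prop} (h : p.wp s Q)
    (hQ : ∀ t s', Q t s' → Q' t s') : p.wp s Q' := by
  obtain ⟨t, s', he, hq⟩ := h
  exact ⟨t, s', he, hQ _ _ hq⟩

theorem wp_skip {s : RamState} {Q : ℕ → RamState → Prop} : skip.wp s Q ↔ Q 1 s := by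
  constructor
  · rintro ⟨t, s', he, hq⟩
    cases he
    exact hq
  · exact fun h => ⟨1, s, .skip s, h⟩

theorem wp_instr {o : RamInstr} {s : RamState} {Q : ℕ → RamState → Prop} :
    (instr o).wp s Q ↔ Q 1 (o.apply s) := by
  constructor
  · rintro ⟨t, s', he, hq⟩
    cases he
    exact hq
  · exact fun h => ⟨1, _, .instr o s, h⟩

theorem wp_seq {p q : RamProg} {s : RamState} {Q : ℕ → RamState → Prop} :
    (seq p q).wp s Q ↔ p.wp s fun t s' => q.wp s' fun t' s'' => Q (t + t') s'' := by
  constructor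
  · rintro ⟨t, s', he, hq⟩
    cases he with
    | seq h₁ h₂ => exact ⟨_, _, h₁, _, _, h₂, hq⟩
  · rintro ⟨t, s', h₁, t', s'', h₂, hq⟩
    exact ⟨_, _, .seq h₁ h₂, hq⟩

theorem wp_cond {b : RamTest} {p q : RamProg} {s : RamState} {Q : ℕ → RamState → Prop} :
    (cond b p q).wp s Q ↔ (b.Holds s → p.wp s fun t s' => Q (1 + t) s') ∧
      (¬ b.Holds s → q.wp s fun t s' => Q (1 + t) s') := by
  constructor
  · rintro ⟨t, s', he, hq⟩
    cases he with
    | cond_true hb h => exact ⟨fun _ => ⟨_, _, h, hq⟩, fun hb' => absurd hb hb'⟩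
    | cond_false hb h => exact ⟨fun hb' => absurd hb' hb, fun _ => ⟨_, _, h, hq⟩⟩
  · rintro ⟨h₁, h₂⟩
    by_cases hb : b.Holds s
    · obtain ⟨t, s', he, hq⟩ := h₁ hb
      exact ⟨_, _, .cond_true hb he, hq⟩
    · obtain ⟨t, s', he, hq⟩ := h₂ hb
      exact ⟨_, _, .cond_false hb he, hq⟩

/-- Loop rule: `I m s` says that the invariant holds in `s` with potential `m`, and each iteration
is paid for by the potential. -/
theorem wp_loop {b : RamTest} {p : RamProg} (I : ℕ → RamState → Prop)
    (step : ∀ m s, I m s → b.Holds s → p.wp s fun t s' => ∃ m', I m' s' ∧ 1 + t + m' ≤ m)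
    (m : ℕ) (s : RamState) (h : I m s) :
    (loop b p).wp s fun t s' => t ≤ m + 1 ∧ ∃ m', I m' s' ∧ ¬ b.Holds s' := by
  -- Each iteration costs at least its test, so the potential strictly decreases. The extra step in
  -- `m + 1` is the final failing test.
  induction m using Nat.strong_induction_on generalizing s with
  | _ m ih =>
    by_cases hb : b.Holds s
    · obtain ⟨t, s', he, m', hI, hm⟩ := step m s h hb
      obtain ⟨t', s'', he', ht', hI'⟩ := ih m' (by omega) s' hI
      exact ⟨_, _, .loop_step hb he he', by omega, hI'⟩
    · exact ⟨1, s, .loop_done hb, by omega, m, h, hb⟩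

end RamProg

/-! ### The greedy algorithm on a rooted tree -/

/-- `par` and `rank` describe `G` as a rooted tree: every edge joins a vertex to its parent,
which has smaller rank; a root is its own parent. -/
structure IsParentMap {V : Type*} (G : SimpleGraph V) (par : V → V) (rank : V → ℕ) : Prop where
  adj : ∀ v, par v ≠ v → G.Adj v (par v)
  lt : ∀ v, par v ≠ v → rank (par v) < rank v
  edge : ∀ u v, G.Adj u v → par u = v ∨ par v = u

/-- State of the greedy algorithm once all vertices of rank at least `k` are treated: `D` is the
set chosen so far, and `F` consists of the vertices that are dominated by a treated child. -/
structure GreedyInv {V : Type*} (G : SimpleGraph V) (c : V → ℕ) (par : V → V) (rank : V → ℕ)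
    (k : ℕ) (D F : Finset V) : Prop where
  ne_zero : ∀ d ∈ D, c d ≠ 0
  dom : ∀ v, k ≤ rank v → v ∈ D ∨ ∃ d ∈ D, G.Adj v d ∧ c v < c d
  flag : ∀ v, v ∈ F ↔ ∃ u ∈ D, k ≤ rank u ∧ par u = v ∧ c v < c u
  packing : ∃ W : Finset V, D.card ≤ W.card ∧
    (∀ w ∈ W, k ≤ rank w ∧ (c w < c (par w) → par w ∈ D) ∧ (¬ c w < c (par w) → w ∈ D)) ∧
    ∀ w ∈ W, ∀ w' ∈ W, ∀ x, (x = w ∨ G.Adj w x ∧ c w < c x) →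
      (x = w' ∨ G.Adj w' x ∧ c w' < c x) → w = w'

section Greedy

variable {V : Type*} {G : SimpleGraph V} {par : V → V} {rank : V → ℕ}

theorem greedyInv_empty (c : V → ℕ) {k : ℕ} (hk : ∀ v, rank v < k) :
    GreedyInv G c par rank k ∅ ∅ where
  ne_zero := by simp
  dom v hv := absurd (hk v) (by omega)
  flag := by simp
  packing := ⟨∅, by simp⟩

/-- Weak duality: a competitor `E` meets the up-neighborhood of each `w ∈ W`, and disjointness makes
the choice of a common element injective on `W`. -/
theorem GreedyInv.isMin {c : G.Coloring ℕ} {D F : Finset V} (h : GreedyInv G c par rank 0 D F) :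
    IsMinUpColorDominating G c D := by
  classical
  have hD : IsUpColorDominating G c D :=
    ⟨fun v hv => (h.dom v (Nat.zero_le _)).resolve_left hv, h.ne_zero⟩
  refine ⟨hD, le_antisymm ?_ (Nat.sInf_le ⟨D, hD, rfl⟩)⟩
  refine le_csInf ⟨_, D, hD, rfl⟩ ?_
  rintro _ ⟨E, hE, rfl⟩
  obtain ⟨W, hDW, -, hW⟩ := h.packing
  refine hDW.trans ?_
  have hx : ∀ w, ∃ x ∈ E, x = w ∨ G.Adj w x ∧ c w < c x := by
    intro w
    by_cases hw : w ∈ E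
    · exact ⟨w, hw, Or.inl rfl⟩
    · obtain ⟨d, hd, hd'⟩ := hE.1 w hw
      exact ⟨d, hd, Or.inr hd'⟩
  choose f hf hf' using hx
  refine Finset.card_le_card_of_injOn f (fun w _ => hf w) ?_
  intro w hw w' hw' hff
  exact hW w hw w' hw' (f w) (hf' w) (hff ▸ hf' w')

variable [DecidableEq V]

/-- Treating the vertex `v`: effect on the chosen set. -/
def greedySet (c : V → ℕ) (par : V → V) (v : V) (D F : Finset V) : Finset V :=
  if v ∈ D ∨ v ∈ F then D else if c v < c (par v) then insert (par v) D else insert v D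

/-- Treating the vertex `v`: effect on the set of dominated vertices; `D` is the new chosen set. -/
def greedyFlag (c : V → ℕ) (par : V → V) (v : V) (D F : Finset V) : Finset V :=
  if v ∈ D ∧ c (par v) < c v then insert (par v) F else F

/-- If the chosen set grows, `v` is not dominated yet, and it joins the packing to pay for the new
element. -/
theorem GreedyInv.step {c : G.Coloring ℕ} {D F : Finset V} {v : V}
    (hT : IsParentMap G par rank) (hinj : Function.Injective rank)
    (hroot : ∀ v, par v = v → c v ≠ 0) (h : GreedyInv G c par rank (rank v + 1) D F) :
    GreedyInv G c par rank (rank v) (greedySet c par v D F)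
      (greedyFlag c par v (greedySet c par v D F) F) := by
  have hrank : ∀ u, rank v ≤ rank u → u = v ∨ rank v + 1 ≤ rank u := by
    intro u hu
    rcases hu.eq_or_lt with h | h
    · exact Or.inl (hinj h.symm)
    · exact Or.inr h
  have hpar : rank (par v) ≤ rank v := by
    by_cases hp : par v = v
    · rw [hp]
    · exact (hT.lt v hp).le
  have hsub : D ⊆ greedySet c par v D F := by
    unfold greedySet
    split_ifs
    · exact subset_rfl
    · exact Finset.subset_insert _ _
    · exact Finset.subset_insert _ _
  have hnew : ∀ u ∈ greedySet c par v D F, u ∈ D ∨ rank u ≤ rank v := by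
    unfold greedySet
    intro u hu
    split_ifs at hu
    · exact Or.inl hu
    · rcases Finset.mem_insert.1 hu with rfl | hu
      exacts [Or.inr hpar, Or.inl hu]
    · rcases Finset.mem_insert.1 hu with rfl | hu
      exacts [Or.inr le_rfl, Or.inl hu]
  have hdesc : ∀ u w, G.Adj u w → par w ≠ w → par w = u → rank u < rank w := by
    rintro u w - hw rfl
    exact hT.lt w hw
  refine ⟨?_, ?_, ?_, ?_⟩
  · intro d hd
    unfold greedySet at hd
    split_ifs at hd with h1 h2
    · exact h.ne_zero d hd
    · rcases Finset.mem_insert.1 hd with rfl | hd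
      · omega
      · exact h.ne_zero d hd
    · rcases Finset.mem_insert.1 hd with rfl | hd
      -- Here `d = v` is chosen because its parent has no larger color. Off the root, color 0 at `d`
      -- would force color 0 at the parent, against properness.
      · by_cases hp : par d = d
        · exact hroot d hp
        · have := c.valid (hT.adj d hp)
          intro h0
          apply this
          have : c (par d) = 0 := by omega
          rw [h0, this]
      · exact h.ne_zero d hd
  · intro u hu
    rcases hrank u hu with rfl | hu
    · by_cases h1 : u ∈ D
      · exact Or.inl (hsub h1)
      by_cases h2 : u ∈ F
      · obtain ⟨w, hw, hw1, hw2, hw3⟩ := (h.flag u).1 h2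
        refine Or.inr ⟨w, hsub hw, ?_, hw3⟩
        have : par w ≠ w := by
          intro e
          rw [← hw2, e] at hw3
          exact lt_irrefl _ hw3
        have := hT.adj w this
        rw [hw2] at this
        exact this.symm
      by_cases h3 : c u < c (par u)
      · right
        refine ⟨par u, by simp [greedySet, h1, h2, h3], hT.adj u ?_, h3⟩
        intro e
        rw [e] at h3
        exact lt_irrefl _ h3
      · left
        simp [greedySet, h1, h2, h3]
    · rcases h.dom u hu with h1 | ⟨d, hd, h1⟩
      · exact Or.inl (hsub h1)
      · exact Or.inr ⟨d, hsub hd, h1⟩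
  · intro x
    -- New elements have rank at most `rank v`, so membership of the vertices treated earlier is
    -- final and their flags stay exact.
    have key : x ∈ F ↔ ∃ u ∈ greedySet c par v D F, rank v + 1 ≤ rank u ∧ par u = x ∧ c x < c u := by
      rw [h.flag]
      constructor
      · rintro ⟨u, hu, h1⟩
        exact ⟨u, hsub hu, h1⟩
      · rintro ⟨u, hu, h1, h2⟩
        exact ⟨u, (hnew u hu).resolve_right (by omega), h1, h2⟩
    have : x ∈ greedyFlag c par v (greedySet c par v D F) F ↔
        x ∈ F ∨ (v ∈ greedySet c par v D F ∧ par v = x ∧ c x < c v) := by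
      unfold greedyFlag
      split_ifs with h1
      · rw [Finset.mem_insert]
        constructor
        · rintro (rfl | hx)
          exacts [Or.inr ⟨h1.1, rfl, h1.2⟩, Or.inl hx]
        · rintro (hx | ⟨-, hx, -⟩)
          exacts [Or.inr hx, Or.inl hx.symm]
      · constructor
        · exact Or.inl
        · rintro (hx | ⟨hx, rfl, hx'⟩)
          exacts [hx, absurd ⟨hx, hx'⟩ h1]
    rw [this, key]
    constructor
    · rintro (⟨u, hu, h1, h2⟩ | ⟨h1, h2⟩)
      · exact ⟨u, hu, by omega, h2⟩
      · exact ⟨v, h1, le_rfl, h2⟩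
    · rintro ⟨u, hu, h1, h2⟩
      rcases hrank u h1 with rfl | h1
      · exact Or.inr ⟨hu, h2⟩
      · exact Or.inl ⟨u, hu, h1, h2⟩
  · obtain ⟨W, hcard, hW, hdisj⟩ := h.packing
    have hW' : ∀ w ∈ W, rank v ≤ rank w ∧
        (c w < c (par w) → par w ∈ greedySet c par v D F) ∧
        (¬ c w < c (par w) → w ∈ greedySet c par v D F) := fun w hw =>
      ⟨by have := (hW w hw).1; omega, fun h1 => hsub ((hW w hw).2.1 h1),
        fun h1 => hsub ((hW w hw).2.2 h1)⟩
    by_cases htriv : greedySet c par v D F = D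
    · exact ⟨W, by rw [htriv]; exact hcard, hW', hdisj⟩
    have h1 : v ∉ D := fun h1 => htriv (by simp [greedySet, h1])
    have h2 : v ∉ F := fun h2 => htriv (by simp [greedySet, h2])
    -- A dominating parent would make the insertion void, and a dominating child would have flagged
    -- `v`.
    have h3 : ∀ d ∈ D, G.Adj v d → ¬ c v < c d := by
      intro d hd hadj hlt
      rcases hT.edge v d hadj with rfl | hp
      · exact htriv (by simp [greedySet, hlt, hd])
      · refine h2 ((h.flag v).2 ⟨d, hd, ?_, hp, hlt⟩)
        exact hdesc v d hadj (by rintro e; rw [hp] at e; exact hadj.ne e) hp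
    have hvW : v ∉ W := fun hv => by have := (hW v hv).1; omega
    -- No such `x` exists. If `x` is `w` or its parent, then either the ranks conflict or `x` is
    -- already in `D`, hence `v` is chosen or dominated. If `x` is a child of `w`, it lies too far
    -- below for the up-neighborhood of `v` to reach it.
    have hcross : ∀ w ∈ W, ∀ x, (x = w ∨ G.Adj w x ∧ c w < c x) →
        (x = v ∨ G.Adj v x ∧ c v < c x) → w = v := by
      intro w hw x hx hx'
      exfalso
      obtain ⟨hwr, hw1, hw2⟩ := hW w hw
      rcases hx with rfl | ⟨hx, hlt⟩
      · rcases hx' with rfl | ⟨hadj, hlt⟩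
        · exact hvW hw
        · rcases hT.edge v x hadj with hp | hp
          · have := hT.lt v (by rw [hp]; exact hadj.ne')
            rw [hp] at this
            omega
          · refine h3 x (hw2 ?_) hadj hlt
            rw [hp]
            omega
      · rcases hT.edge w x hx with hp | hp
        · subst hp
          have hD := hw1 hlt
          rcases hx' with hx' | ⟨hx', hlt'⟩
          · exact h1 (hx' ▸ hD)
          · exact h3 _ hD hx' hlt'
        · have hr := hT.lt x (by rw [hp]; exact hx.ne)
          rw [hp] at hr
          rcases hx' with hx' | ⟨hx', hlt'⟩
          · subst hx'
            omega
          · rcases hT.edge v x hx' with hp' | hp'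
            · have := hT.lt v (by rw [hp']; exact hx'.ne')
              rw [hp'] at this
              omega
            · rw [hp] at hp'
              exact hvW (hp' ▸ hw)
    refine ⟨insert v W, ?_, ?_, ?_⟩
    · rw [Finset.card_insert_of_notMem hvW]
      refine le_trans ?_ (Nat.succ_le_succ hcard)
      unfold greedySet
      split_ifs
      · omega
      · exact Finset.card_insert_le _ _
      · exact Finset.card_insert_le _ _
    · intro w hw
      rcases Finset.mem_insert.1 hw with rfl | hw
      · refine ⟨le_rfl, fun h4 => ?_, fun h4 => ?_⟩ <;> simp [greedySet, h1, h2, h4]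
      · exact hW' w hw
    · intro w hw w' hw' x hx hx'
      rcases Finset.mem_insert.1 hw with rfl | hwW
      · rcases Finset.mem_insert.1 hw' with rfl | hwW'
        · rfl
        · exact (hcross w' hwW' x hx' hx).symm
      · rcases Finset.mem_insert.1 hw' with rfl | hwW'
        · exact hcross w hwW x hx hx'
        · exact hdisj w hwW w' hwW' x hx hx'

end Greedy

/-! ### Search trees -/

/-- `Q` lists the vertices found so far by a graph search started at `r`, and `par v` is the
vertex from which `v` was found. -/
structure IsSearch {V : Type*} [DecidableEq V] (G : SimpleGraph V) (r : V) (Q : List V)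
    (par : V → V) : Prop where
  nodup : Q.Nodup
  root_mem : r ∈ Q
  par_root : par r = r
  par_mem : ∀ v ∈ Q, par v ∈ Q
  adj : ∀ v ∈ Q, v ≠ r → G.Adj v (par v)
  lt : ∀ v ∈ Q, v ≠ r → Q.idxOf (par v) < Q.idxOf v

section Search

variable {V : Type*} [DecidableEq V] {G : SimpleGraph V} {r : V} {Q : List V} {par : V → V}

theorem isSearch_singleton (G : SimpleGraph V) (r : V) : IsSearch G r [r] fun _ => r := by
  constructor <;> simp

/-- Appending changes no earlier position, so the parent order survives. Any found vertex `v` may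
serve as parent of the new one. -/
theorem IsSearch.append (h : IsSearch G r Q par) {v w : V} (hv : v ∈ Q) (hw : w ∉ Q)
    (hadj : G.Adj v w) : IsSearch G r (Q ++ [w]) (Function.update par w v) := by
  have hne : ∀ u ∈ Q, u ≠ w := fun u hu e => hw (e ▸ hu)
  have hlt : ∀ u ∈ Q, (Q ++ [w]).idxOf u < (Q ++ [w]).idxOf w := by
    intro u hu
    rw [List.idxOf_append_of_mem hu, List.idxOf_append_of_notMem hw]
    have := List.idxOf_lt_length_of_mem hu
    omega
  constructor
  · rw [List.nodup_append]
    refine ⟨h.nodup, by simp, ?_⟩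
    intro a ha b hb
    rw [List.mem_singleton.1 hb]
    exact hne a ha
  · exact List.mem_append_left _ h.root_mem
  · rw [Function.update_of_ne (hne r h.root_mem), h.par_root]
  · intro u hu
    rcases List.mem_append.1 hu with hu | hu
    · rw [Function.update_of_ne (hne u hu)]
      exact List.mem_append_left _ (h.par_mem u hu)
    · rw [List.mem_singleton.1 hu, Function.update_self]
      exact List.mem_append_left _ hv
  · intro u hu hur
    rcases List.mem_append.1 hu with hu | hu
    · rw [Function.update_of_ne (hne u hu)]
      exact h.adj u hu hur
    · rw [List.mem_singleton.1 hu, Function.update_self]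
      exact hadj.symm
  · intro u hu hur
    rcases List.mem_append.1 hu with hu | hu
    · rw [Function.update_of_ne (hne u hu), List.idxOf_append_of_mem hu,
        List.idxOf_append_of_mem (h.par_mem u hu)]
      exact h.lt u hu hur
    · rw [List.mem_singleton.1 hu, Function.update_self]
      exact hlt v hv

theorem IsSearch.mem_of_closed (h : IsSearch G r Q par) (hG : G.Connected)
    (hcl : ∀ u ∈ Q, ∀ w, G.Adj u w → w ∈ Q) (v : V) : v ∈ Q := by
  obtain ⟨p⟩ := hG.preconnected r v
  have key : ∀ a b : V, G.Walk a b → a ∈ Q → b ∈ Q := by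
    intro a b p
    induction p with
    | nil => exact id
    | cons hadj _ ih => exact fun ha => ih (hcl _ ha _ hadj)
  exact key r v p h.root_mem

/-- Counting: the edges from non-root vertices to their parents are distinct, since two vertices
cannot each precede the other in `Q`. There are as many of them as the tree has edges, so no other
edge exists. -/
theorem IsSearch.isParentMap [Fintype V] (h : IsSearch G r Q par) (hG : G.IsTree)
    (hQ : ∀ v, v ∈ Q) : IsParentMap G par Q.idxOf := by
  classical
  have hr : ∀ v, par v ≠ v → v ≠ r := by
    rintro v hv rfl
    exact hv h.par_root
  refine ⟨fun v hv => h.adj v (hQ v) (hr v hv), fun v hv => h.lt v (hQ v) (hr v hv), ?_⟩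
  have himg : (Finset.univ.erase r).image (fun v => s(v, par v)) = G.edgeFinset := by
    apply Finset.eq_of_subset_of_card_le
    · intro e he
      obtain ⟨v, hv, rfl⟩ := Finset.mem_image.1 he
      simpa using h.adj v (hQ v) (Finset.ne_of_mem_erase hv)
    · rw [Finset.card_image_of_injOn]
      · have := hG.card_edgeFinset
        rw [Finset.card_erase_of_mem (Finset.mem_univ r), Finset.card_univ]
        omega
      · intro u hu v hv huv
        have hu' := h.lt u (hQ u) (Finset.ne_of_mem_erase hu)
        have hv' := h.lt v (hQ v) (Finset.ne_of_mem_erase hv)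
        rcases Sym2.eq_iff.1 huv with ⟨h1, -⟩ | ⟨h1, h2⟩
        · exact h1
        · rw [h2] at hu'
          rw [← h1] at hv'
          omega
  intro u v huv
  have : s(u, v) ∈ G.edgeFinset := by simpa using huv
  rw [← himg] at this
  obtain ⟨w, -, hw⟩ := Finset.mem_image.1 this
  rcases Sym2.eq_iff.1 hw with ⟨rfl, h2⟩ | ⟨rfl, h2⟩
  · exact Or.inl h2
  · exact Or.inr h2

end Search

/-! ### Adjacency lists -/

section Adjacency

variable {n : ℕ}

/-- The position in the concatenated adjacency lists at which the list of vertex `i` starts. -/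
def adjOffset (nbrs : Fin n → List (Fin n)) (i : ℕ) : ℕ :=
  (((List.finRange n).take i).flatMap nbrs).length

theorem take_succ_finRange (v : Fin n) :
    (List.finRange n).take (v + 1) = (List.finRange n).take v ++ [v] := by
  rw [List.take_add_one]
  simp

theorem adjOffset_succ (nbrs : Fin n → List (Fin n)) (v : Fin n) :
    adjOffset nbrs (v + 1) = adjOffset nbrs v + (nbrs v).length := by
  simp [adjOffset, take_succ_finRange]

theorem getD_flatMap_finRange (nbrs : Fin n → List (Fin n)) (v : Fin n) {j : ℕ}
    (hj : j < (nbrs v).length) :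
    (((List.finRange n).flatMap nbrs).map Fin.val).getD (adjOffset nbrs v + j) 0 =
      ((nbrs v)[j] : ℕ) := by
  have h : (List.finRange n).flatMap nbrs =
      ((List.finRange n).take v).flatMap nbrs ++
        (nbrs v ++ ((List.finRange n).drop (v + 1)).flatMap nbrs) := by
    conv_lhs => rw [← List.take_append_drop (v + 1) (List.finRange n), take_succ_finRange]
    simp
  rw [h]
  simp [adjOffset, List.getD_eq_getElem?_getD, List.getElem?_append, hj]

theorem IsAdjacencyList.sum_length {T : SimpleGraph (Fin n)} {nbrs : Fin n → List (Fin n)}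
    (h : IsAdjacencyList T nbrs) (hT : T.IsTree) : ∑ v, (nbrs v).length + 2 = 2 * n := by
  classical
  have h1 : ∀ v, (nbrs v).length = T.degree v := by
    intro v
    rw [← List.toFinset_card_of_nodup (h v).1, ← SimpleGraph.card_neighborFinset_eq_degree]
    congr 1
    ext w
    simp [(h v).2 w]
  rw [Finset.sum_congr rfl fun v _ => h1 v, T.sum_degrees_eq_twice_card_edges]
  have := hT.card_edgeFinset
  rw [Fintype.card_fin] at this
  omega

end Adjacency

/-! ### The program -/

open RamProg RamInstr RamTest in
/-- Puts the smallest vertex of nonzero color into register `1`. -/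
def findRootProg : RamProg :=
  .seq (.instr (load 2 0 1)) (.loop (eq 2 3) (.seq (.instr (succ 1)) (.instr (load 2 0 1))))

open RamProg RamInstr RamTest in
/-- Starts a search: array `4` is the queue with its head and tail in registers `4` and `5`,
array `5` stores parents, array `6` marks the vertices that have been found. -/
def initSearchProg : RamProg :=
  .seq (.instr (store 4 4 1)) (.seq (.instr (succ 5)) (.seq (.instr (store 5 1 1))
    (.seq (.instr (const 6 1)) (.instr (store 6 1 6)))))

open RamProg RamInstr RamTest in
/-- Looks at the entry of the adjacency list of the vertex in register `7` to which register `8`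
points, and moves on to the next entry. -/
def visitNeighborProg : RamProg :=
  .seq (.instr (load 11 2 8)) (.seq (.instr (load 12 6 11))
    (.seq (.cond (eq 12 3)
      (.seq (.instr (store 4 5 11)) (.seq (.instr (succ 5)) (.seq (.instr (store 5 11 7))
        (.instr (store 6 11 6))))) .skip) (.instr (succ 8))))

open RamProg RamInstr RamTest in
/-- Takes a vertex from the queue and finds the bounds of its adjacency list. -/
def dequeueProg : RamProg :=
  .seq (.instr (load 7 4 4)) (.seq (.instr (load 8 1 7)) (.seq (.instr (copy 10 7))
    (.seq (.instr (succ 10)) (.instr (load 9 1 10)))))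

open RamProg RamInstr RamTest in
/-- Breadth-first search. -/
def searchProg : RamProg :=
  .loop (lt 4 5) (.seq dequeueProg (.seq (.loop (lt 8 9) visitNeighborProg) (.instr (succ 4))))

open RamProg RamInstr RamTest in
/-- Loads the vertex before the head of the queue, its parent, and their colors. -/
def loadVertexProg : RamProg :=
  .seq (.instr (pred 4)) (.seq (.instr (load 7 4 4)) (.seq (.instr (load 8 5 7))
    (.seq (.instr (load 9 0 7)) (.instr (load 10 0 8)))))

open RamProg RamInstr RamTest in
/-- Makes sure that the loaded vertex is chosen or dominated. -/
def chooseProg : RamProg :=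
  .seq (.instr (load 11 3 7)) (.seq (.instr (load 12 7 7))
    (.cond (eq 11 3) (.cond (eq 12 3)
      (.cond (lt 9 10) (.instr (store 3 8 6)) (.instr (store 3 7 6))) .skip) .skip))

open RamProg RamInstr RamTest in
/-- Marks the parent of the loaded vertex if it is dominated by that vertex. -/
def flagProg : RamProg :=
  .seq (.instr (load 11 3 7))
    (.cond (eq 11 6) (.cond (lt 10 9) (.instr (store 7 8 6)) .skip) .skip)

/-- Finds a smallest up-color dominating set of a colored tree. -/
def upColorDominationProg : RamProg :=
  .seq findRootProg (.seq initSearchProg (.seq searchProg 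
    (.loop (.lt 3 4) (.seq loadVertexProg (.seq chooseProg flagProg)))))

/-! ### Correctness of the program -/

section Correctness

open RamProg

variable {n : ℕ} {T : SimpleGraph (Fin n)} {c : Fin n → ℕ} {nbrs : Fin n → List (Fin n)}
  {r : Fin n} {Q : List (Fin n)} {par : Fin n → Fin n} {s : RamState}

/-- The parts of the state that no phase of the program changes, and the arrays `4`
to `6` of a search. -/
structure SearchInv (T : SimpleGraph (Fin n)) (c : Fin n → ℕ) (nbrs : Fin n → List (Fin n))
    (r : Fin n) (Q : List (Fin n)) (par : Fin n → Fin n) (s : RamState) : Prop where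
  color : ∀ v : Fin n, s.mem 0 v = c v
  offset : ∀ i ≤ n, s.mem 1 i = adjOffset nbrs i
  nbr : ∀ (v : Fin n) (j : ℕ) (hj : j < (nbrs v).length),
    s.mem 2 (adjOffset nbrs v + j) = (nbrs v)[j]
  chosen : ∀ i, s.mem 3 i = 0
  flagged : ∀ i, s.mem 7 i = 0
  zero : s.reg 3 = 0
  one : s.reg 6 = 1
  tail : s.reg 5 = Q.length
  queue : ∀ (i : ℕ) (hi : i < Q.length), s.mem 4 i = Q[i]
  parent : ∀ v ∈ Q, s.mem 5 v = par v
  found : ∀ v : Fin n, s.mem 6 v = if v ∈ Q then 1 else 0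
  search : IsSearch T r Q par

/-! ### Root choice and breadth-first search on the machine -/

theorem graphInput_wp_findRoot (h : ∃ v, c v ≠ 0) :
    findRootProg.wp (graphInput c nbrs) fun t s => t ≤ 3 * n + 2 ∧
      ∃ r : Fin n, c r ≠ 0 ∧ s.mem = (graphInput c nbrs).mem ∧ s.reg 1 = r ∧
        ∀ x, x ≠ 1 → x ≠ 2 → s.reg x = (graphInput c nbrs).reg x := by
  obtain ⟨v₀, hv₀⟩ := h
  have hmem : ∀ v : Fin n, (graphInput c nbrs).mem 0 v = c v := fun v => by simp [graphInput]
  rw [findRootProg, wp_seq, wp_instr]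
  -- Any nonzero vertex `v₀` bounds the scan. An iteration takes one test and two instructions,
  -- hence the factor 3.
  refine wp_mono (wp_loop (fun m s => s.mem = (graphInput c nbrs).mem ∧ s.reg 1 ≤ v₀ ∧
    s.reg 2 = s.mem 0 (s.reg 1) ∧ m = 3 * (v₀ - s.reg 1) ∧
    ∀ x, x ≠ 1 → x ≠ 2 → s.reg x = (graphInput c nbrs).reg x) ?_ (3 * v₀) _ ?_) ?_
  · rintro m s ⟨h1, h2, h3, h4, h5⟩ hb
    have h6 : s.reg 2 = 0 := by
      rw [RamTest.Holds, h5 3 (by decide) (by decide)] at hb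
      simpa [graphInput] using hb
    have hlt : s.reg 1 < v₀ := by
      refine lt_of_le_of_ne h2 fun e => hv₀ ?_
      rw [← hmem, ← e, ← h1, ← h3, h6]
    rw [wp_seq, wp_instr, wp_instr]
    refine ⟨3 * (v₀ - (s.reg 1 + 1)), ⟨?_, ?_, ?_, ?_, ?_⟩, by omega⟩
    · simpa [RamInstr.apply, RamState.setReg] using h1
    · simpa [RamInstr.apply, RamState.setReg] using hlt
    · simp [RamInstr.apply, RamState.setReg]
    · simp [RamInstr.apply, RamState.setReg]
    · intro x hx1 hx2
      simpa [RamInstr.apply, RamState.setReg, Function.update_apply, hx1, hx2] using h5 x hx1 hx2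
  · refine ⟨rfl, ?_, ?_, ?_, ?_⟩
    · simp [RamInstr.apply, RamState.setReg, graphInput]
    · simp [RamInstr.apply, RamState.setReg]
    · simp [RamInstr.apply, RamState.setReg, graphInput]
    · intro x hx1 hx2
      simp [RamInstr.apply, RamState.setReg, hx2]
  · rintro t s ⟨ht, m, ⟨h1, h2, h3, -, h5⟩, hb⟩
    have hn := v₀.isLt
    refine ⟨by omega, ⟨s.reg 1, by omega⟩, ?_, h1, rfl, h5⟩
    rw [RamTest.Holds, h5 3 (by decide) (by decide), h3, h1] at hb
    rw [← hmem]
    simpa [graphInput] using hb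

theorem wp_initSearch (h1 : s.mem = (graphInput c nbrs).mem) (h2 : s.reg 1 = r)
    (h3 : ∀ x, x ≠ 1 → x ≠ 2 → s.reg x = (graphInput c nbrs).reg x) :
    initSearchProg.wp s fun t s' => t = 5 ∧ SearchInv T c nbrs r [r] (fun _ => r) s' ∧
      s'.reg 4 = 0 := by
  have e3 : s.reg 3 = 0 := by rw [h3 3 (by decide) (by decide)]; simp [graphInput]
  have e4 : s.reg 4 = 0 := by rw [h3 4 (by decide) (by decide)]; simp [graphInput]
  have e5 : s.reg 5 = 0 := by rw [h3 5 (by decide) (by decide)]; simp [graphInput]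
  simp only [initSearchProg, wp_seq, wp_instr]
  refine ⟨trivial, ⟨?_, ?_, ?_, ?_, ?_, ?_, ?_, ?_, ?_, ?_, ?_, isSearch_singleton T r⟩, ?_⟩
  · intro v
    simp [RamInstr.apply, RamState.setReg, RamState.setMem, h1, graphInput]
  · intro i hi
    simp [RamInstr.apply, RamState.setReg, RamState.setMem, h1, graphInput, hi, adjOffset]
  · intro v j hj
    simpa [RamInstr.apply, RamState.setReg, RamState.setMem, h1, graphInput]
      using getD_flatMap_finRange nbrs v hj
  · simp [RamInstr.apply, RamState.setReg, RamState.setMem, h1, graphInput]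
  · simp [RamInstr.apply, RamState.setReg, RamState.setMem, h1, graphInput]
  · simpa [RamInstr.apply, RamState.setReg, RamState.setMem] using e3
  · simp [RamInstr.apply, RamState.setReg, RamState.setMem]
  · simpa [RamInstr.apply, RamState.setReg, RamState.setMem] using e5
  · intro i hi
    obtain rfl : i = 0 := by simpa using hi
    simp [RamInstr.apply, RamState.setReg, RamState.setMem, e4, h2]
  · intro v hv
    obtain rfl : v = r := by simpa using hv
    simp [RamInstr.apply, RamState.setReg, RamState.setMem, h2]
  · intro v
    simp [RamInstr.apply, RamState.setReg, RamState.setMem, h1, h2, graphInput,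
      Function.update_apply, Fin.val_inj]
  · simpa [RamInstr.apply, RamState.setReg, RamState.setMem] using e4

/-- Writing to registers other than `3`, `5`, `6` preserves the search invariant. -/
theorem SearchInv.congr (h : SearchInv T c nbrs r Q par s) {s' : RamState}
    (hm : s'.mem = s.mem) (h3 : s'.reg 3 = s.reg 3) (h5 : s'.reg 5 = s.reg 5)
    (h6 : s'.reg 6 = s.reg 6) : SearchInv T c nbrs r Q par s' := by
  refine ⟨?_, ?_, ?_, ?_, ?_, ?_, ?_, ?_, ?_, ?_, ?_, h.search⟩
  · rw [hm]; exact h.color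
  · rw [hm]; exact h.offset
  · rw [hm]; exact h.nbr
  · rw [hm]; exact h.chosen
  · rw [hm]; exact h.flagged
  · rw [h3]; exact h.zero
  · rw [h6]; exact h.one
  · rw [h5]; exact h.tail
  · rw [hm]; exact h.queue
  · rw [hm]; exact h.parent
  · rw [hm]; exact h.found

theorem SearchInv.wp_visitNeighbor (h : SearchInv T c nbrs r Q par s) {v : Fin n} (hv : v ∈ Q)
    (hnb : IsAdjacencyList T nbrs) (h7 : s.reg 7 = v) {j : ℕ} (hj : j < (nbrs v).length)
    (h8 : s.reg 8 = adjOffset nbrs v + j) :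
    visitNeighborProg.wp s fun t s' => t ≤ 8 ∧ ∃ Q' par', SearchInv T c nbrs r Q' par' s' ∧
      Q <+: Q' ∧ (nbrs v)[j] ∈ Q' ∧ s'.reg 4 = s.reg 4 ∧ s'.reg 7 = v ∧
      s'.reg 8 = s.reg 8 + 1 ∧ s'.reg 9 = s.reg 9 := by
  set w := (nbrs v)[j] with hw
  have e : s.mem 2 (s.reg 8) = w := by rw [h8, h.nbr v j hj]
  have hadj : T.Adj v w := ((hnb v).2 w).1 (List.getElem_mem hj)
  simp only [visitNeighborProg, wp_seq, wp_instr, wp_cond, wp_skip]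
  have hf := h.found w
  have hz := h.zero
  constructor
  · intro hb
    have hwQ : w ∉ Q := by
      intro hwQ
      simp [RamTest.Holds, RamInstr.apply, RamState.setReg, e, hf, hz, hwQ] at hb
    refine ⟨by omega, Q ++ [w], Function.update par w v,
      ⟨?_, ?_, ?_, ?_, ?_, ?_, ?_, ?_, ?_, ?_, ?_, h.search.append hv hwQ hadj⟩,
      List.prefix_append _ _, by simp, ?_, ?_, ?_, ?_⟩
    · simpa [RamInstr.apply, RamState.setReg, RamState.setMem] using h.color
    · simpa [RamInstr.apply, RamState.setReg, RamState.setMem] using h.offset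
    · simpa [RamInstr.apply, RamState.setReg, RamState.setMem] using h.nbr
    · simpa [RamInstr.apply, RamState.setReg, RamState.setMem] using h.chosen
    · simpa [RamInstr.apply, RamState.setReg, RamState.setMem] using h.flagged
    · simpa [RamInstr.apply, RamState.setReg, RamState.setMem] using h.zero
    · simpa [RamInstr.apply, RamState.setReg, RamState.setMem] using h.one
    · simpa [RamInstr.apply, RamState.setReg, RamState.setMem] using h.tail
    · intro i hi
      rw [List.length_append, List.length_singleton] at hi
      rcases (Nat.lt_succ_iff.1 hi).lt_or_eq with hi | rfl
      · rw [List.getElem_append_left hi, ← h.queue i hi]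
        simp [RamInstr.apply, RamState.setReg, RamState.setMem, h.tail, hi.ne]
      · simp [RamInstr.apply, RamState.setReg, RamState.setMem, h.tail, e]
    · intro u hu
      rcases eq_or_ne u w with rfl | huw
      · simp [RamInstr.apply, RamState.setReg, RamState.setMem, e, h7]
      · have : u ∈ Q := by simpa [huw] using hu
        simp [RamInstr.apply, RamState.setReg, RamState.setMem, e,
          Fin.val_inj, huw, h.parent u this]
    · intro u
      rcases eq_or_ne u w with rfl | huw
      · simp [RamInstr.apply, RamState.setReg, RamState.setMem, e, h.one]
      · simp [RamInstr.apply, RamState.setReg, RamState.setMem, e,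
          Fin.val_inj, huw, h.found u]
    · simp [RamInstr.apply, RamState.setReg, RamState.setMem]
    · simpa [RamInstr.apply, RamState.setReg, RamState.setMem] using h7
    · simp [RamInstr.apply, RamState.setReg, RamState.setMem]
    · simp [RamInstr.apply, RamState.setReg, RamState.setMem]
  · intro hb
    have hwQ : w ∈ Q := by
      by_contra hwQ
      simp [RamTest.Holds, RamInstr.apply, RamState.setReg, e, hf, hz, hwQ] at hb
    refine ⟨by omega, Q, par, h.congr rfl ?_ ?_ ?_, List.prefix_rfl, hwQ, ?_, ?_, ?_, ?_⟩ <;>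
      simp [RamInstr.apply, RamState.setReg, h7]

theorem SearchInv.wp_visitNeighbors (h : SearchInv T c nbrs r Q par s) {v : Fin n} (hv : v ∈ Q)
    (hnb : IsAdjacencyList T nbrs) (h7 : s.reg 7 = v) (h8 : s.reg 8 = adjOffset nbrs v)
    (h9 : s.reg 9 = adjOffset nbrs v + (nbrs v).length) :
    (loop (.lt 8 9) visitNeighborProg).wp s fun t s' => t ≤ 9 * (nbrs v).length + 1 ∧
      ∃ Q' par', SearchInv T c nbrs r Q' par' s' ∧ Q <+: Q' ∧ (∀ w, T.Adj v w → w ∈ Q') ∧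
        s'.reg 4 = s.reg 4 := by
  -- `j` counts the entries already read. Each costs at most 8 steps plus the loop test.
  refine wp_mono (wp_loop (fun m s' => ∃ Q' par' j, SearchInv T c nbrs r Q' par' s' ∧ Q <+: Q' ∧
    s'.reg 4 = s.reg 4 ∧ s'.reg 7 = v ∧ s'.reg 8 = adjOffset nbrs v + j ∧
    s'.reg 9 = adjOffset nbrs v + (nbrs v).length ∧ j ≤ (nbrs v).length ∧
    (∀ (i : ℕ) (hi : i < (nbrs v).length), i < j → (nbrs v)[i] ∈ Q') ∧
    m = 9 * ((nbrs v).length - j)) ?_ (9 * (nbrs v).length) s ?_) ?_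
  · rintro m s' ⟨Q', par', j, hs, hQ, e4, e7, e8, e9, hj, hall, rfl⟩ hb
    rw [RamTest.Holds, e8, e9] at hb
    have hj' : j < (nbrs v).length := by omega
    refine wp_mono (hs.wp_visitNeighbor (hQ.subset hv) hnb e7 hj' e8) ?_
    rintro t s'' ⟨ht, Q'', par'', hs', hQ', hw, f4, f7, f8, f9⟩
    refine ⟨9 * ((nbrs v).length - (j + 1)), ⟨Q'', par'', j + 1, hs', hQ.trans hQ', by rw [f4, e4],
      f7, by omega, by omega, by omega, ?_, rfl⟩, by omega⟩
    intro i hi hij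
    rcases (Nat.lt_succ_iff.1 hij).lt_or_eq with hij | rfl
    · exact hQ'.subset (hall i hi hij)
    · exact hw
  · exact ⟨Q, par, 0, h, List.prefix_rfl, rfl, h7, h8, h9, Nat.zero_le _, by simp, rfl⟩
  · rintro t s' ⟨ht, m, ⟨Q', par', j, hs, hQ, e4, e7, e8, e9, hj, hall, -⟩, hb⟩
    refine ⟨ht, Q', par', hs, hQ, ?_, e4⟩
    intro w hw
    rw [RamTest.Holds, e8, e9] at hb
    obtain ⟨i, hi, rfl⟩ := List.getElem_of_mem (((hnb v).2 w).2 hw)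
    exact hall i hi (by omega)

theorem SearchInv.wp_dequeue (h : SearchInv T c nbrs r Q par s) (h4 : s.reg 4 < Q.length) :
    dequeueProg.wp s fun t s' => t = 5 ∧ SearchInv T c nbrs r Q par s' ∧ s'.reg 4 = s.reg 4 ∧
      s'.reg 7 = Q[s.reg 4] ∧ s'.reg 8 = adjOffset nbrs Q[s.reg 4] ∧
      s'.reg 9 = adjOffset nbrs Q[s.reg 4] + (nbrs Q[s.reg 4]).length := by
  have e := h.queue _ h4
  set v := Q[s.reg 4]
  have e1 := h.offset v v.isLt.le
  -- The list of `v` ends where the next one starts. The offset array has a cell for index `n`, so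
  -- the last vertex is no exception.
  have e2 := h.offset (v + 1) v.isLt
  rw [adjOffset_succ] at e2
  simp only [dequeueProg, wp_seq, wp_instr]
  refine ⟨trivial, h.congr rfl ?_ ?_ ?_, ?_, ?_, ?_, ?_⟩ <;>
    simp [RamInstr.apply, RamState.setReg, e, e1, e2]

theorem SearchInv.wp_search (h : SearchInv T c nbrs r Q par s) (h4 : s.reg 4 = 0)
    (hT : T.IsTree) (hnb : IsAdjacencyList T nbrs) :
    searchProg.wp s fun t s' => t ≤ 28 * n + 1 ∧ ∃ Q' par', SearchInv T c nbrs r Q' par' s' ∧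
      (∀ v, v ∈ Q') ∧ s'.reg 4 = Q'.length := by
  -- `A` is the part of the queue already removed, and the potential is spread over the vertices
  -- outside `A`. The 8 covers the outer test, 5 dequeue steps, the last inner test and the advance
  -- of the head.
  refine wp_mono (wp_loop (fun m s' => ∃ Q' par' A, SearchInv T c nbrs r Q' par' s' ∧ A <+: Q' ∧
    s'.reg 4 = A.length ∧ (∀ u ∈ A, ∀ w, T.Adj u w → w ∈ Q') ∧
    m = ∑ v ∈ A.toFinsetᶜ, (9 * (nbrs v).length + 8)) ?_
    (∑ v, (9 * (nbrs v).length + 8)) s ?_) ?_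
  · rintro m s₁ ⟨Q₁, par₁, A, hs, hA, e4, hcl, rfl⟩ hb
    rw [RamTest.Holds, hs.tail] at hb
    rw [wp_seq]
    refine wp_mono (hs.wp_dequeue hb) ?_
    rintro t₂ s₂ ⟨rfl, hs₂, f4, f7, f8, f9⟩
    set v := Q₁[s₁.reg 4] with hv
    have hAv : A ++ [v] <+: Q₁ := by
      obtain ⟨B, rfl⟩ := hA
      cases B with
      | nil => simp [e4] at hb
      | cons b B =>
        have : v = b := by simp [hv, e4]
        exact ⟨B, by simp [this]⟩
    have hvA : v ∉ A := by
      have := hAv.sublist.nodup hs.search.nodup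
      rw [List.nodup_append] at this
      exact fun hvA => this.2.2 v hvA v (by simp) rfl
    have hvQ : v ∈ Q₁ := hAv.subset (by simp)
    rw [wp_seq]
    refine wp_mono (hs₂.wp_visitNeighbors hvQ hnb f7 f8 f9) ?_
    rintro t₃ s₃ ⟨ht₃, Q₃, par₃, hs₃, hQ₃, hw, g4⟩
    rw [wp_instr]
    refine ⟨_, ⟨Q₃, par₃, A ++ [v], hs₃.congr rfl ?_ ?_ ?_, hAv.trans hQ₃, ?_, ?_, rfl⟩, ?_⟩
    · simp [RamInstr.apply, RamState.setReg]
    · simp [RamInstr.apply, RamState.setReg]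
    · simp [RamInstr.apply, RamState.setReg]
    · simp [RamInstr.apply, RamState.setReg, g4, f4, e4]
    · intro u hu w huw
      rcases List.mem_append.1 hu with hu | hu
      · exact hQ₃.subset (hcl u hu w huw)
      · rw [List.mem_singleton.1 hu] at huw
        exact hw w huw
    · have : (A ++ [v]).toFinsetᶜ = A.toFinsetᶜ.erase v := by
        ext u
        simp [and_comm]
      rw [this, ← Finset.add_sum_erase (A.toFinsetᶜ) _ (by simpa using hvA : v ∈ A.toFinsetᶜ)]
      omega
  · exact ⟨Q, par, [], h, List.nil_prefix, h4, by simp, by simp⟩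
  · rintro t s' ⟨ht, m, ⟨Q', par', A, hs, hA, e4, hcl, -⟩, hb⟩
    rw [RamTest.Holds, hs.tail, e4] at hb
    -- With the queue exhausted, all found vertices have had their lists read, so the found set is
    -- closed under adjacency and connectedness makes it everything.
    obtain rfl : A = Q' := hA.eq_of_length (le_antisymm hA.length_le (not_lt.1 hb))
    refine ⟨?_, A, par', hs, hs.search.mem_of_closed hT.connected hcl, e4⟩
    have := hnb.sum_length hT
    rw [Finset.sum_add_distrib, ← Finset.mul_sum] at ht
    simp only [Finset.sum_const, Finset.card_univ, Fintype.card_fin, smul_eq_mul] at ht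
    omega

/-- The state during the greedy algorithm: `D` in array `3`, `F` in array `7`. -/
structure GreedyStateInv (c : Fin n → ℕ) (Q : List (Fin n)) (par : Fin n → Fin n)
    (D F : Finset (Fin n)) (s : RamState) : Prop where
  color : ∀ v : Fin n, s.mem 0 v = c v
  queue : ∀ (i : ℕ) (hi : i < Q.length), s.mem 4 i = Q[i]
  parent : ∀ v : Fin n, s.mem 5 v = par v
  chosen : ∀ v : Fin n, s.mem 3 v = if v ∈ D then 1 else 0
  flagged : ∀ v : Fin n, s.mem 7 v = if v ∈ F then 1 else 0
  zero : s.reg 3 = 0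
  one : s.reg 6 = 1

/-- Vertex `v`, its parent and their colors are in registers `7` to `10`. -/
structure VertexLoaded (c : Fin n → ℕ) (par : Fin n → Fin n) (v : Fin n) (s : RamState) :
    Prop where
  vertex : s.reg 7 = v
  parent : s.reg 8 = par v
  color : s.reg 9 = c v
  color_parent : s.reg 10 = c (par v)

/-! ### The greedy phase on the machine -/

variable {D F : Finset (Fin n)} {v : Fin n}

theorem GreedyStateInv.wp_loadVertex (h : GreedyStateInv c Q par D F s)
    (h4 : s.reg 4 - 1 < Q.length) :
    loadVertexProg.wp s fun t s' => t = 5 ∧ GreedyStateInv c Q par D F s' ∧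
      VertexLoaded c par Q[s.reg 4 - 1] s' ∧ s'.reg 4 = s.reg 4 - 1 := by
  have e := h.queue _ h4
  set v := Q[s.reg 4 - 1]
  have e1 := h.parent v
  have e2 := h.color v
  have e3 := h.color (par v)
  simp only [loadVertexProg, wp_seq, wp_instr]
  refine ⟨trivial, ⟨h.color, h.queue, h.parent, h.chosen, h.flagged, h.zero, h.one⟩,
    ⟨?_, ?_, ?_, ?_⟩, ?_⟩ <;>
    simp [RamInstr.apply, RamState.setReg, e, e1, e2, e3]

theorem GreedyStateInv.wp_choose (h : GreedyStateInv c Q par D F s)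
    (hv : VertexLoaded c par v s) :
    chooseProg.wp s fun t s' => t ≤ 6 ∧ GreedyStateInv c Q par (greedySet c par v D F) F s' ∧
      VertexLoaded c par v s' ∧ s'.reg 4 = s.reg 4 := by
  have e1 := h.chosen v
  have e2 := h.flagged v
  have e3 := h.zero
  have e4 := h.one
  have e5 := hv.vertex
  have e6 := hv.parent
  have e7 := hv.color
  have e8 := hv.color_parent
  by_cases h1 : v ∈ D
  · have hg : greedySet c par v D F = D := by simp [greedySet, h1]
    rw [hg]
    simp [chooseProg, wp_seq, wp_instr, wp_cond, wp_skip, RamTest.Holds, RamInstr.apply,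
      RamState.setReg, RamState.setMem, e1, e2, e3, e4, e5, e6, e7, e8, h1]
    exact ⟨⟨h.color, h.queue, h.parent, h.chosen, h.flagged, h.zero, h.one⟩, ⟨e5, e6, e7, e8⟩⟩
  by_cases h2 : v ∈ F
  · have hg : greedySet c par v D F = D := by simp [greedySet, h2]
    rw [hg]
    simp [chooseProg, wp_seq, wp_instr, wp_cond, wp_skip, RamTest.Holds, RamInstr.apply,
      RamState.setReg, RamState.setMem, e1, e2, e3, e4, e5, e6, e7, e8, h1, h2]
    exact ⟨⟨h.color, h.queue, h.parent, h.chosen, h.flagged, h.zero, h.one⟩, ⟨e5, e6, e7, e8⟩⟩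
  by_cases h3 : c v < c (par v)
  · have hg : greedySet c par v D F = insert (par v) D := by simp [greedySet, h1, h2, h3]
    rw [hg]
    simp [chooseProg, wp_seq, wp_instr, wp_cond, wp_skip, RamTest.Holds, RamInstr.apply,
      RamState.setReg, RamState.setMem, e1, e2, e3, e4, e5, e6, e7, e8, h1, h2, h3]
    refine ⟨⟨h.color, h.queue, h.parent, ?_, h.flagged, h.zero, h.one⟩, ⟨e5, e6, e7, e8⟩⟩
    intro u
    by_cases hu : u = par v <;> simp [Fin.val_inj, hu, h.chosen]
  · have hg : greedySet c par v D F = insert v D := by simp [greedySet, h1, h2, h3]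
    rw [hg]
    simp [chooseProg, wp_seq, wp_instr, wp_cond, wp_skip, RamTest.Holds, RamInstr.apply,
      RamState.setReg, RamState.setMem, e1, e2, e3, e4, e5, e6, e7, e8, h1, h2, h3]
    refine fun _ => ⟨⟨h.color, h.queue, h.parent, ?_, h.flagged, h.zero, h.one⟩, ⟨e5, e6, e7, e8⟩⟩
    intro u
    by_cases hu : u = v <;> simp [Fin.val_inj, hu, h.chosen]

theorem GreedyStateInv.wp_flag (h : GreedyStateInv c Q par D F s)
    (hv : VertexLoaded c par v s) :
    flagProg.wp s fun t s' => t ≤ 4 ∧ GreedyStateInv c Q par D (greedyFlag c par v D F) s' ∧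
      s'.reg 4 = s.reg 4 := by
  have e1 := h.chosen v
  have e4 := h.one
  have e5 := hv.vertex
  have e6 := hv.parent
  have e7 := hv.color
  have e8 := hv.color_parent
  by_cases h1 : v ∈ D
  · by_cases h2 : c (par v) < c v
    · have hg : greedyFlag c par v D F = insert (par v) F := by simp [greedyFlag, h1, h2]
      rw [hg]
      simp [flagProg, wp_seq, wp_instr, wp_cond, wp_skip, RamTest.Holds, RamInstr.apply,
        RamState.setReg, RamState.setMem, e1, e4, e5, e6, e7, e8, h1, h2]
      refine ⟨h.color, h.queue, h.parent, h.chosen, ?_, h.zero, h.one⟩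
      intro u
      by_cases hu : u = par v <;> simp [Fin.val_inj, hu, h.flagged]
    · have hg : greedyFlag c par v D F = F := by simp [greedyFlag, h2]
      rw [hg]
      simp [flagProg, wp_seq, wp_instr, wp_cond, wp_skip, RamTest.Holds, RamInstr.apply,
        RamState.setReg, RamState.setMem, e1, e4, e5, e6, e7, e8, h1, h2]
      exact fun _ => ⟨h.color, h.queue, h.parent, h.chosen, h.flagged, h.zero, h.one⟩
  · have hg : greedyFlag c par v D F = F := by simp [greedyFlag, h1]
    rw [hg]
    simp [flagProg, wp_seq, wp_instr, wp_cond, wp_skip, RamTest.Holds, RamInstr.apply,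
      RamState.setReg, RamState.setMem, e1, e4, e5, e6, e7, e8, h1]
    exact ⟨h.color, h.queue, h.parent, h.chosen, h.flagged, h.zero, h.one⟩

theorem SearchInv.wp_greedy {c : T.Coloring ℕ} (h : SearchInv T c nbrs r Q par s)
    (hT : T.IsTree) (hr : c r ≠ 0) (hQ : ∀ v, v ∈ Q) (h4 : s.reg 4 = Q.length) :
    (loop (.lt 3 4) (.seq loadVertexProg (.seq chooseProg flagProg))).wp s fun t s' =>
      t ≤ 16 * n + 1 ∧ ∃ D, s'.Outputs D ∧ IsMinUpColorDominating T c D := by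
  have hpm := h.search.isParentMap hT hQ
  have hinj : Function.Injective fun v => Q.idxOf v := fun u v huv =>
    (List.idxOf_inj (hQ u)).1 huv
  have hroot : ∀ v, par v = v → c v ≠ 0 := by
    intro v hv
    by_cases hvr : v = r
    · rwa [hvr]
    · exact absurd hv (h.search.adj v (hQ v) hvr).ne'
  have hlen : Q.length = n := by
    rw [← List.toFinset_card_of_nodup h.search.nodup,
      (Finset.eq_univ_of_forall fun v => by simpa using hQ v : Q.toFinset = Finset.univ)]
    simp
  -- The rank is the queue position, and register `4` is the threshold above which, inclusively, all
  -- is treated. An iteration costs at most 1 + 5 + 6 + 4 = 16.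
  refine wp_mono (wp_loop (fun m s' => ∃ D F, GreedyStateInv c Q par D F s' ∧
    GreedyInv T c par (Q.idxOf ·) (s'.reg 4) D F ∧ s'.reg 4 ≤ Q.length ∧ m = 16 * s'.reg 4)
    ?_ (16 * n) s ?_) ?_
  · rintro m s₁ ⟨D, F, hs, hg, hk, rfl⟩ hb
    rw [RamTest.Holds, hs.zero] at hb
    have hlt : s₁.reg 4 - 1 < Q.length := by omega
    rw [wp_seq]
    refine wp_mono (hs.wp_loadVertex hlt) ?_
    rintro t₂ s₂ ⟨rfl, hs₂, hv₂, f4⟩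
    rw [wp_seq]
    refine wp_mono (hs₂.wp_choose hv₂) ?_
    rintro t₃ s₃ ⟨ht₃, hs₃, hv₃, g4⟩
    refine wp_mono (hs₃.wp_flag hv₃) ?_
    rintro t₄ s₄ ⟨ht₄, hs₄, k4⟩
    have hrank : Q.idxOf Q[s₁.reg 4 - 1] = s₁.reg 4 - 1 := h.search.nodup.idxOf_getElem _ hlt
    have e4 : s₄.reg 4 = Q.idxOf Q[s₁.reg 4 - 1] := by rw [k4, g4, f4, hrank]
    refine ⟨_, ⟨_, _, hs₄, ?_, by omega, rfl⟩, by omega⟩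
    rw [e4]
    refine GreedyInv.step hpm hinj hroot ?_
    rwa [hrank, Nat.sub_add_cancel hb]
  · refine ⟨∅, ∅, ⟨h.color, h.queue, fun v => h.parent v (hQ v), by simp [h.chosen],
      by simp [h.flagged], h.zero, h.one⟩, greedyInv_empty _ fun v => ?_, h4.le, by rw [h4, hlen]⟩
    rw [h4]
    exact List.idxOf_lt_length_of_mem (hQ v)
  · rintro t s' ⟨ht, m, ⟨D, F, hs, hg, -⟩, hb⟩
    rw [RamTest.Holds, hs.zero, Nat.pos_iff_ne_zero, not_not] at hb
    rw [hb] at hg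
    exact ⟨ht, D, hs.chosen, hg.isMin⟩

end Correctness

/-- Requiring a nonzero color excludes only the one-vertex tree of color 0, since any edge carries
two different colors. -/
theorem mainTheorem7 :
    ∃ (P : RamProg) (C : ℕ), ∀ (n : ℕ) (T : SimpleGraph (Fin n)) (c : T.Coloring ℕ)
      (nbrs : Fin n → List (Fin n)),
      T.IsTree → (∃ v, c v ≠ 0) → IsAdjacencyList T nbrs →
      ∃ (t : ℕ) (s : RamState) (D : Finset (Fin n)),
        RamExec P (graphInput c nbrs) t s ∧ t ≤ C * n ∧
        s.Outputs D ∧ IsMinUpColorDominating T c D := by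
  -- The phases take at most `3 * n + 2`, 5, `28 * n + 1` and `16 * n + 1` steps, in total `47 * n +
  -- 9`, which is at most `56 * n` as `n ≥ 1`.
  refine ⟨upColorDominationProg, 56, fun n T c nbrs hT hc hnb => ?_⟩
  have hn : 0 < n := hc.choose.pos
  suffices h : upColorDominationProg.wp (graphInput c nbrs) fun t s =>
      t ≤ 56 * n ∧ ∃ D, s.Outputs D ∧ IsMinUpColorDominating T c D by
    obtain ⟨t, s, he, ht, D, hD⟩ := h
    exact ⟨t, s, D, he, ht, hD⟩
  rw [upColorDominationProg, RamProg.wp_seq]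
  refine RamProg.wp_mono (graphInput_wp_findRoot hc) ?_
  rintro t₁ s₁ ⟨ht₁, r, hr, hm, h1, hreg⟩
  rw [RamProg.wp_seq]
  refine RamProg.wp_mono (wp_initSearch (T := T) hm h1 hreg) ?_
  rintro t₂ s₂ ⟨rfl, hs₂, h4⟩
  rw [RamProg.wp_seq]
  refine RamProg.wp_mono (hs₂.wp_search h4 hT hnb) ?_
  rintro t₃ s₃ ⟨ht₃, Q, par, hs₃, hQ, h4'⟩
  refine RamProg.wp_mono (hs₃.wp_greedy hT hr hQ h4') ?_
  rintro t₄ s₄ ⟨ht₄, hD⟩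
  exact ⟨by omega, hD⟩
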